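/- Let $\mathbb C_+=\{s\in\mathbb C:\operatorname{Re}s>0\}$, and let $\mathcal H^\infty$ be the Banach space of all bounded analytic functions $f:\mathbb C_+\to\mathbb C$ that can be written as a convergent Dirichlet series $f(s)=\sum_{n\ge1}a_nn^{-s}$ in some half-plane $\{\operatorname{Re}s>\theta\}$, with the norm $\|f\|=\sup_{s\in\mathbb C_+}|f(s)|$. A composition operator on $\mathcal H^\infty$ is a bounded linear operator $T:\mathcal H^\infty\to\mathcal H^\infty$ of the form $Tf=f\circ\Phi$ for all $f\in\mathcal H^\infty$, where $\Phi:\mathbb C_+\to\mathbb C_+$ is analytic. Let $\{T_t\}_{t\ge0}$ be a strongly continuous semigroup of composition operators on $\mathcal H^\infty$: each $T_t$ is a composition operator, $T_0=\mathrm{Id}$, $T_t\circ T_u=T_{t+u}$ for all $t,u\ge0$, and $\lim_{t\to0^+}\|T_tf-f\|=0$ for every $f\in\mathcal H^\infty$. Then $T_t=\mathrm{Id}$ for every $t\ge0$. -/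

import Mathlib

open Filter Topology
open scoped NNReal BoundedContinuousFunction

/-- The open right half-plane `ℂ₊ = {s : 0 < Re s}`, with the topology of `ℂ`. -/
abbrev RightHalfPlane : Type := {s : ℂ // 0 < s.re}

/-- `f` is analytic (holomorphic) on the open right half-plane: as a function on an open subset of
`ℂ`, extended to `ℂ` in any way, it is complex differentiable at all points of the half-plane. -/
def IsHolomorphic (f : RightHalfPlane → ℂ) : Prop :=
  ∃ F : ℂ → ℂ, DifferentiableOn ℂ F {s : ℂ | 0 < s.re} ∧ ∀ s : RightHalfPlane, F s = f s

/-- `f` can be written as a Dirichlet series `∑ aₙ n⁻ˢ` (ordinary convergence of the partial sums)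
in a certain half-plane `Re s > θ`. -/
def IsDirichletSeries (f : RightHalfPlane → ℂ) : Prop :=
  ∃ (a : ℕ → ℂ) (θ : ℝ), ∀ s : RightHalfPlane, θ < (s : ℂ).re →
    Tendsto (fun N : ℕ => ∑ n ∈ Finset.Icc 1 N, a n * (n : ℂ) ^ (-(s : ℂ))) atTop (𝓝 (f s))

/-- The Hardy space `𝓗^∞` of Dirichlet series: the bounded analytic functions on the right
half-plane that can be written as a Dirichlet series in some half-plane. As a subspace of the bounded
continuous functions on the half-plane it carries the supremum norm. -/
noncomputable def HardyInfty : Submodule ℂ (RightHalfPlane →ᵇ ℂ) where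
  carrier := {f | IsHolomorphic f ∧ IsDirichletSeries f}
  zero_mem' := by
    refine ⟨⟨0, differentiableOn_const 0, fun s => rfl⟩, 0, 0, fun s _ => ?_⟩
    simp
  add_mem' := by
    rintro f g ⟨⟨F, hF, hFf⟩, a, θ, ha⟩ ⟨⟨G, hG, hGg⟩, b, η, hb⟩
    refine ⟨⟨F + G, hF.add hG, fun s => by simp [hFf, hGg]⟩, a + b, max θ η, fun s hs => ?_⟩
    have h := (ha s (lt_of_le_of_lt (le_max_left _ _) hs)).add
      (hb s (lt_of_le_of_lt (le_max_right _ _) hs))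
    simpa [add_mul, Finset.sum_add_distrib] using h
  smul_mem' := by
    rintro c f ⟨⟨F, hF, hFf⟩, a, θ, ha⟩
    refine ⟨⟨c • F, hF.const_smul c, fun s => by simp [hFf]⟩, c • a, θ, fun s hs => ?_⟩
    have h := (ha s hs).const_mul c
    simpa [Finset.mul_sum, mul_assoc] using h

/-- A bounded operator `T` on `𝓗^∞` is a composition operator if `T f = f ∘ Φ` for all `f`, for some
analytic symbol `Φ : ℂ₊ → ℂ₊`. -/
def IsCompositionOperator (T : HardyInfty →L[ℂ] HardyInfty) : Prop :=
  ∃ Φ : RightHalfPlane → RightHalfPlane, IsHolomorphic (fun s => (Φ s : ℂ)) ∧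
    ∀ (f : HardyInfty) (s : RightHalfPlane),
      (T f : RightHalfPlane →ᵇ ℂ) s = (f : RightHalfPlane →ᵇ ℂ) (Φ s)

/-- A strongly continuous (`C₀`-) semigroup `(T_t)_{t ≥ 0}` of bounded operators. -/
structure IsStronglyContinuousSemigroup {X : Type*} [NormedAddCommGroup X] [NormedSpace ℂ X]
    (T : ℝ≥0 → X →L[ℂ] X) : Prop where
  zero : T 0 = ContinuousLinearMap.id ℂ X
  add : ∀ t u : ℝ≥0, (T t).comp (T u) = T (t + u)
  tendsto : ∀ f : X, Tendsto (fun t : ℝ≥0 => T t f) (𝓝[>] 0) (𝓝 f)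

/-! For g bounded analytic on the disc and n ≥ 2, the function g(n⁻ˢ) lies in 𝓗^∞, so strong
continuity can be tested on all of H^∞ of the disc, whose functions oscillate wildly near the
circle. Suppose that, for times tending to 0, symbols move n⁻ˢ by pseudohyperbolic distance at least
1/2 at some points. The test function g(x) = x makes the Euclidean displacement tend to 0, so the
points approach the circle. A Blaschke product vanishing at a subsequence of the starting points and
bounded below at their images then contradicts strong continuity
(`exists_bounded_analytic_frequently_le`, `eventually_pseudoDist_lt`). So for small t the
displacement is uniformly below 1/2 pseudohyperbolically, hence O(1 - |n⁻ˢ|²) in the Euclidean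
sense. It vanishes at Re s = 0, and by Phragmén–Lindelöf everywhere
(`natCast_cpow_neg_eq_of_pseudoDist_lt`). Taking n = 2 and n = 3 forces Φ_t(s) = s, and the
semigroup law carries T_t = Id from small t to all t. -/

open ComplexConjugate in
/-- The pseudohyperbolic distance of the unit disc. -/
noncomputable def pseudoDist (a z : ℂ) : ℝ := ‖a - z‖ / ‖1 - conj a * z‖

open ComplexConjugate in
/-- The Blaschke factor with zero `a`, normalized to be positive at the origin. -/
noncomputable def blaschkeFactor (a z : ℂ) : ℂ := (‖a‖ - conj a / ‖a‖ * z) / (1 - conj a * z)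

/-! ### Pseudohyperbolic distance and Blaschke products. -/

section Disc

open ComplexConjugate

lemma one_sub_norm_mul_norm_le (a z : ℂ) : 1 - ‖a‖ * ‖z‖ ≤ ‖1 - conj a * z‖ := by
  have h := norm_sub_norm_le (1 : ℂ) (conj a * z)
  simpa using h

lemma norm_one_sub_conj_mul_pos {a z : ℂ} (ha : ‖a‖ < 1) (hz : ‖z‖ < 1) :
    0 < ‖1 - conj a * z‖ := by
  have h := one_sub_norm_mul_norm_le a z
  nlinarith [norm_nonneg a, norm_nonneg z]

lemma norm_one_sub_conj_mul_sq_sub (a z : ℂ) :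
    ‖1 - conj a * z‖ ^ 2 - ‖a - z‖ ^ 2 = (1 - ‖a‖ ^ 2) * (1 - ‖z‖ ^ 2) := by
  simp only [← Complex.normSq_eq_norm_sq, Complex.normSq_apply]
  simp
  ring

lemma pseudoDist_nonneg (a z : ℂ) : 0 ≤ pseudoDist a z := by unfold pseudoDist; positivity

lemma pseudoDist_comm (a z : ℂ) : pseudoDist a z = pseudoDist z a := by
  unfold pseudoDist
  rw [norm_sub_rev, ← Complex.norm_conj (1 - conj a * z)]
  simp [mul_comm]

lemma pseudoDist_le_one {a z : ℂ} (ha : ‖a‖ < 1) (hz : ‖z‖ < 1) : pseudoDist a z ≤ 1 := by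
  have h := norm_one_sub_conj_mul_sq_sub a z
  have h1 : 0 ≤ (1 - ‖a‖ ^ 2) * (1 - ‖z‖ ^ 2) :=
    mul_nonneg (by nlinarith [norm_nonneg a]) (by nlinarith [norm_nonneg z])
  refine div_le_one_of_le₀ ?_ (norm_nonneg _)
  exact le_of_sq_le_sq (by linarith) (norm_nonneg _)

/-- Since ρ ≤ 1, 1 - ρ ≤ 1 - ρ² = (1 - |a|²)(1 - |z|²)/|1 - āz|², and |1 - āz| ≥ 1 - |a|. Thus a
fixed a is at distance nearly 1 from every point near the circle. -/
lemma one_sub_pseudoDist_le {a z : ℂ} (ha : ‖a‖ < 1) (hz : ‖z‖ < 1) :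
    1 - pseudoDist a z ≤ 2 / (1 - ‖a‖) * (1 - ‖z‖ ^ 2) := by
  have hp := norm_one_sub_conj_mul_pos ha hz
  have h := norm_one_sub_conj_mul_sq_sub a z
  have h0 := pseudoDist_nonneg a z
  have h1 := pseudoDist_le_one ha hz
  have h2 : 1 - ‖a‖ ≤ ‖1 - conj a * z‖ := by
    have := one_sub_norm_mul_norm_le a z
    nlinarith [norm_nonneg a, norm_nonneg z]
  have hz' : 0 ≤ 1 - ‖z‖ ^ 2 := by nlinarith [norm_nonneg z]
  have h3 : 1 - pseudoDist a z ^ 2 = (1 - ‖a‖ ^ 2) * (1 - ‖z‖ ^ 2) / ‖1 - conj a * z‖ ^ 2 := by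
    rw [← h, pseudoDist, div_pow, sub_div, div_self (by positivity)]
  have h4 : (1 - ‖a‖ ^ 2) * (1 - ‖z‖ ^ 2) / ‖1 - conj a * z‖ ^ 2
      ≤ 2 / (1 - ‖a‖) * (1 - ‖z‖ ^ 2) := by
    have ha' : 0 < 1 - ‖a‖ := by linarith
    calc (1 - ‖a‖ ^ 2) * (1 - ‖z‖ ^ 2) / ‖1 - conj a * z‖ ^ 2
        ≤ (1 - ‖a‖ ^ 2) * (1 - ‖z‖ ^ 2) / (1 - ‖a‖) ^ 2 := by
          have : 0 ≤ 1 - ‖a‖ ^ 2 := by nlinarith [norm_nonneg a]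
          gcongr
      _ = (1 + ‖a‖) / (1 - ‖a‖) * (1 - ‖z‖ ^ 2) := by field_simp; ring
      _ ≤ _ := by
          gcongr
          linarith
  nlinarith

lemma eventually_one_sub_le_pseudoDist {ι : Type*} {l : Filter ι} {a : ℂ} {w : ι → ℂ} (ha : ‖a‖ < 1)
    (hw : ∀ k, ‖w k‖ < 1) (hwt : Tendsto (fun k => ‖w k‖) l (𝓝 1)) {ε : ℝ} (hε : 0 < ε) :
    ∀ᶠ k in l, 1 - ε ≤ pseudoDist a (w k) := by
  have h : Tendsto (fun k => 2 / (1 - ‖a‖) * (1 - ‖w k‖ ^ 2)) l (𝓝 0) := by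
    simpa using ((hwt.pow 2).const_sub 1).const_mul (2 / (1 - ‖a‖))
  filter_upwards [h.eventually_lt_const hε] with k hk
  linarith [one_sub_pseudoDist_le ha (hw k)]

lemma norm_blaschkeFactor {a : ℂ} (ha : a ≠ 0) (z : ℂ) :
    ‖blaschkeFactor a z‖ = pseudoDist a z := by
  have h0 : ((‖a‖ : ℝ) : ℂ) ≠ 0 := by simpa using ha
  have h : (‖a‖ : ℂ) - conj a / ‖a‖ * z = conj a / ‖a‖ * (a - z) := by
    have : conj a * a = (‖a‖ : ℂ) ^ 2 := Complex.conj_mul' a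
    field_simp
    rw [mul_sub, this]
  have h1 : ‖conj a / (‖a‖ : ℂ)‖ = 1 := by
    have : ‖a‖ ≠ 0 := by simpa using ha
    simp [this]
  rw [blaschkeFactor, h, norm_div, norm_mul, h1, one_mul, pseudoDist]

/-- The normalization lets 1 - |a| factor out of the difference; this makes ∑ (1 - |aᵢ|) < ∞ enough
for convergence of the product. -/
lemma norm_blaschkeFactor_sub_one_le {a z : ℂ} (ha0 : a ≠ 0) (ha : ‖a‖ < 1) (hz : ‖z‖ < 1) :
    ‖blaschkeFactor a z - 1‖ ≤ 2 / (1 - ‖z‖) * (1 - ‖a‖) := by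
  have h0 : ((‖a‖ : ℝ) : ℂ) ≠ 0 := by simpa using ha0
  have hp := norm_one_sub_conj_mul_pos ha hz
  have hp' : 1 - conj a * z ≠ 0 := norm_pos_iff.mp hp
  have h : blaschkeFactor a z - 1
      = -(((1 - ‖a‖ : ℝ) : ℂ) * (1 + conj a / ‖a‖ * z) / (1 - conj a * z)) := by
    rw [blaschkeFactor]
    push_cast
    field_simp
    ring
  have h1 : ‖conj a / (‖a‖ : ℂ)‖ = 1 := by
    have : ‖a‖ ≠ 0 := by simpa using ha0
    simp [this]
  have h2 : ‖1 + conj a / ‖a‖ * z‖ ≤ 2 := by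
    refine (norm_add_le _ _).trans ?_
    rw [norm_mul, h1]
    simp
    linarith
  have h3 : 1 - ‖z‖ ≤ ‖1 - conj a * z‖ := by
    have := one_sub_norm_mul_norm_le a z
    nlinarith [norm_nonneg a, norm_nonneg z]
  have ha' : 0 ≤ 1 - ‖a‖ := by linarith
  have hz' : 0 < 1 - ‖z‖ := by linarith
  rw [h, norm_neg, norm_div, norm_mul, Complex.norm_real, Real.norm_of_nonneg ha']
  calc (1 - ‖a‖) * ‖1 + conj a / ‖a‖ * z‖ / ‖1 - conj a * z‖
      ≤ (1 - ‖a‖) * 2 / (1 - ‖z‖) := by gcongr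
    _ = _ := by ring

lemma differentiableOn_blaschkeFactor {a : ℂ} (ha : ‖a‖ < 1) :
    DifferentiableOn ℂ (blaschkeFactor a) (Metric.ball 0 1) := by
  unfold blaschkeFactor
  refine DifferentiableOn.div (by fun_prop) (by fun_prop) fun z hz => ?_
  exact norm_pos_iff.mp (norm_one_sub_conj_mul_pos ha (by simpa using hz))

lemma blaschkeFactor_self {a : ℂ} (ha : a ≠ 0) : blaschkeFactor a a = 0 := by
  rw [← norm_eq_zero, norm_blaschkeFactor ha]
  simp [pseudoDist]

/-- Convergence of Blaschke products. -/
lemma hasProdLocallyUniformlyOn_blaschkeFactor {a : ℕ → ℂ} (ha0 : ∀ i, a i ≠ 0)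
    (ha : ∀ i, ‖a i‖ < 1) (hs : Summable fun i => 1 - ‖a i‖) :
    HasProdLocallyUniformlyOn (fun i z => blaschkeFactor (a i) z)
      (fun z => ∏' i, blaschkeFactor (a i) z) (Metric.ball 0 1) := by
  refine hasProdLocallyUniformlyOn_of_forall_compact Metric.isOpen_ball fun K hK hKc => ?_
  obtain ⟨r, hr, hKr⟩ : ∃ r < 1, K ⊆ Metric.closedBall (0 : ℂ) r := by
    obtain ⟨r, hr, h⟩ := exists_lt_subset_ball hKc.isClosed hK
    exact ⟨r, hr, h.trans Metric.ball_subset_closedBall⟩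
  have h := Summable.hasProdUniformlyOn_nat_one_add (f := fun i z => blaschkeFactor (a i) z - 1)
    hKc (hs.mul_left (2 / (1 - r))) (.of_forall fun i z hz => ?_)
    fun i => (((differentiableOn_blaschkeFactor (ha i)).continuousOn.mono hK).sub continuousOn_const)
  · simpa using h
  · have hzr : ‖z‖ ≤ r := by simpa using hKr hz
    refine (norm_blaschkeFactor_sub_one_le (ha0 i) (ha i) (hzr.trans_lt hr)).trans ?_
    have h1 : 0 < 1 - r := by linarith
    have h2 : 0 ≤ 1 - ‖a i‖ := by linarith [ha i]
    gcongr

/-- Weierstrass product inequality, used to bound a Blaschke product below away from its zeros. -/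
lemma one_sub_sum_le_prod {ι : Type*} (s : Finset ι) {x ε : ι → ℝ} (h0 : ∀ i ∈ s, 0 ≤ x i)
    (h1 : ∀ i ∈ s, x i ≤ 1) (h : ∀ i ∈ s, 1 - ε i ≤ x i) :
    1 - ∑ i ∈ s, ε i ≤ ∏ i ∈ s, x i := by
  classical
  induction s using Finset.induction_on with
  | empty => simp
  | insert i s hi ih =>
    simp only [Finset.mem_insert, forall_eq_or_imp] at h0 h1 h
    rw [Finset.sum_insert hi, Finset.prod_insert hi]
    have h2 := ih h0.2 h1.2 h.2
    have h3 := Finset.prod_le_one h0.2 h1.2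
    nlinarith [h.1, h1.1, h0.1]

/-- Along sequences tending to the unit circle with pseudohyperbolic distances bounded below, some
bounded analytic function on the disc oscillates. -/
theorem exists_bounded_analytic_frequently_le {z w : ℕ → ℂ} (hz : ∀ k, ‖z k‖ < 1)
    (hw : ∀ k, ‖w k‖ < 1) (hzt : Tendsto (fun k => ‖z k‖) atTop (𝓝 1))
    (hwt : Tendsto (fun k => ‖w k‖) atTop (𝓝 1)) (hρ : ∀ k, 1 / 2 ≤ pseudoDist (z k) (w k)) :
    ∃ g : ℂ → ℂ, DifferentiableOn ℂ g (Metric.ball 0 1) ∧ (∀ x ∈ Metric.ball (0 : ℂ) 1, ‖g x‖ ≤ 1) ∧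
      ∃ᶠ k in atTop, 1 / 4 ≤ ‖g (z k) - g (w k)‖ := by
  -- Greedy choice of pairs (label, index). The selection principle does not see the position in the
  -- sequence; the strictly increasing label stands in for it and sets the error size. In both
  -- inequalities the error is labelled by the zero z, whether the point w comes later or earlier.
  obtain ⟨f, hfP, hfr⟩ := exists_seq_of_forall_finset_exists
    (fun p : ℕ × ℕ => 1 - (1 / 2 : ℝ) ^ (p.1 + 1) < ‖z p.2‖)
    (fun p q => p.1 < q.1 ∧ p.2 < q.2 ∧
      1 - (1 / 2 : ℝ) ^ (p.1 + 2) ≤ pseudoDist (z p.2) (w q.2) ∧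
      1 - (1 / 2 : ℝ) ^ (q.1 + 2) ≤ pseudoDist (z q.2) (w p.2)) (by
    intro s _
    have hlabel : ∃ l, ∀ x ∈ s, x.1 < l := ⟨s.sup Prod.fst + 1, fun x hx =>
      Nat.lt_succ_of_le (Finset.le_sup (f := Prod.fst) hx)⟩
    obtain ⟨l, hl⟩ := hlabel
    have h1 : ∀ᶠ k in atTop, 1 - (1 / 2 : ℝ) ^ (l + 1) < ‖z k‖ :=
      hzt.eventually_const_lt (by simp)
    have h2 : ∀ᶠ k in atTop, ∀ x ∈ s, x.2 < k ∧
        1 - (1 / 2 : ℝ) ^ (x.1 + 2) ≤ pseudoDist (z x.2) (w k) ∧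
        1 - (1 / 2 : ℝ) ^ (l + 2) ≤ pseudoDist (z k) (w x.2) := by
      rw [Finset.eventually_all]
      intro x _
      filter_upwards [eventually_gt_atTop x.2,
        eventually_one_sub_le_pseudoDist (hz x.2) hw hwt (ε := (1 / 2 : ℝ) ^ (x.1 + 2))
          (by positivity),
        eventually_one_sub_le_pseudoDist (hw x.2) hz hzt (ε := (1 / 2 : ℝ) ^ (l + 2))
          (by positivity)] with k a b c
      exact ⟨a, b, by rwa [pseudoDist_comm]⟩
    obtain ⟨k, hk1, hk2⟩ := (h1.and h2).exists
    exact ⟨(l, k), hk1, fun x hx => ⟨hl x hx, hk2 x hx⟩⟩)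
  have hmono1 : StrictMono fun n => (f n).1 := fun m n h => (hfr m n h).1
  have hmono2 : StrictMono fun n => (f n).2 := fun m n h => (hfr m n h).2.1
  set a : ℕ → ℂ := fun n => z (f n).2 with ha
  set b : ℕ → ℂ := fun n => w (f n).2 with hb
  have hpow (n k : ℕ) : (1 / 2 : ℝ) ^ ((f n).1 + k) ≤ (1 / 2) ^ (n + k) :=
    pow_le_pow_of_le_one (by norm_num) (by norm_num) (Nat.add_le_add_right (hmono1.id_le n) k)
  have ha1 (i) : ‖a i‖ < 1 := hz _
  have hb1 (i) : ‖b i‖ < 1 := hw _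
  have hale (i) : 1 - ‖a i‖ ≤ (1 / 2) ^ (i + 1) := by
    linarith [hfP i, hpow i 1]
  have ha0 (i) : a i ≠ 0 := by
    rw [← norm_pos_iff]
    have : (1 / 2 : ℝ) ^ (i + 1) ≤ 1 / 2 := by
      rw [pow_succ]
      nlinarith [pow_le_one₀ (n := i) (by norm_num : (0 : ℝ) ≤ 1 / 2) (by norm_num)]
    linarith [hale i]
  have hgeom : HasSum (fun i : ℕ => (1 / 2 : ℝ) ^ (i + 2)) (1 / 2) := by
    have h := hasSum_geometric_two.mul_right (1 / 4 : ℝ)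
    have he : (fun i : ℕ => (1 / 2 : ℝ) ^ (i + 2)) = fun i => (1 / 2) ^ i * (1 / 4) := by
      funext i
      ring
    rw [he]
    rwa [show (2 : ℝ) * (1 / 4) = 1 / 2 by norm_num] at h
  have hsum : Summable fun i => 1 - ‖a i‖ := by
    refine Summable.of_nonneg_of_le (fun i => by linarith [ha1 i]) hale ?_
    simpa only [pow_succ] using (summable_geometric_two).mul_right (1 / 2 : ℝ)
  have hne (i j : ℕ) (hij : i ≠ j) : 1 - (1 / 2 : ℝ) ^ (i + 2) ≤ pseudoDist (a i) (b j) := by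
    rcases lt_or_gt_of_ne hij with h | h
    · linarith [(hfr i j h).2.2.1, hpow i 2]
    · linarith [(hfr j i h).2.2.2, hpow i 2]
  have hprod := hasProdLocallyUniformlyOn_blaschkeFactor ha0 ha1 hsum
  set g : ℂ → ℂ := fun x => ∏' i, blaschkeFactor (a i) x with hg
  have hlim (x : ℂ) (hx : ‖x‖ < 1) :
      Tendsto (fun N => ∏ i ∈ Finset.range N, blaschkeFactor (a i) x) atTop (𝓝 (g x)) :=
    (hprod.hasProd (by simpa using hx)).tendsto_prod_nat
  refine ⟨g, ?_, fun x hx => ?_, ?_⟩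
  · refine TendstoLocallyUniformlyOn.differentiableOn
      (hasProdLocallyUniformlyOn_iff_tendstoLocallyUniformlyOn.mp hprod) (.of_forall fun s => ?_)
      Metric.isOpen_ball
    exact DifferentiableOn.fun_finsetProd fun i _ => differentiableOn_blaschkeFactor (ha1 i)
  · have hx' : ‖x‖ < 1 := by simpa using hx
    refine le_of_tendsto (hlim x hx').norm (.of_forall fun N => ?_)
    rw [norm_prod]
    refine Finset.prod_le_one (fun _ _ => norm_nonneg _) fun i _ => ?_
    rw [norm_blaschkeFactor (ha0 i)]
    exact pseudoDist_le_one (ha1 i) hx'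
  · refine hmono2.tendsto_atTop.frequently (p := fun k => 1 / 4 ≤ ‖g (z k) - g (w k)‖)
      (Frequently.of_forall fun j => ?_)
    have hga : g (a j) = 0 := by
      refine tendsto_nhds_unique (hlim _ (ha1 j)) (tendsto_const_nhds.congr' ?_)
      filter_upwards [eventually_gt_atTop j] with N hN
      exact (Finset.prod_eq_zero (Finset.mem_range.mpr hN) (blaschkeFactor_self (ha0 j))).symm
    have hgb : 1 / 4 ≤ ‖g (b j)‖ := by
      refine ge_of_tendsto (hlim _ (hb1 j)).norm ?_
      filter_upwards [eventually_gt_atTop j] with N hN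
      rw [norm_prod, ← Finset.mul_prod_erase _ _ (Finset.mem_range.mpr hN)]
      simp only [norm_blaschkeFactor (ha0 _)]
      -- The errors 2^-(i+2) sum to 1/2, so the factors with i ≠ j contribute at least 1/2; the
      -- factor j contributes another 1/2 by `hρ`, whence 1/4.
      have h1 := one_sub_sum_le_prod ((Finset.range N).erase j)
        (x := fun i => pseudoDist (a i) (b j)) (ε := fun i => (1 / 2 : ℝ) ^ (i + 2))
        (fun i _ => pseudoDist_nonneg _ _) (fun i _ => pseudoDist_le_one (ha1 i) (hb1 j))
        fun i hi => hne i j (Finset.ne_of_mem_erase hi)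
      have h2 : ∑ i ∈ (Finset.range N).erase j, (1 / 2 : ℝ) ^ (i + 2) ≤ 1 / 2 :=
        sum_le_hasSum _ (fun _ _ => by positivity) hgeom
      have h3 : 1 / 2 ≤ pseudoDist (a j) (b j) := hρ _
      nlinarith
    change 1 / 4 ≤ ‖g (a j) - g (b j)‖
    rwa [hga, zero_sub, norm_neg]

end Disc

/-! ### Transfer from the disc to Dirichlet series. -/

lemma norm_natCast_cpow_neg_lt_one {n : ℕ} (hn : 2 ≤ n) {s : ℂ} (hs : 0 < s.re) :
    ‖(n : ℂ) ^ (-s)‖ < 1 := by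
  rw [Complex.norm_natCast_cpow_of_pos (by lia)]
  exact Real.rpow_lt_one_of_one_lt_of_neg (by exact_mod_cast hn) (by simpa using hs)

/-- `s ↦ g (n⁻ˢ)` belongs to `𝓗^∞` when `g` is bounded and analytic on the unit disc. -/
theorem exists_hardyInfty_comp_cpow {n : ℕ} (hn : 2 ≤ n) {g : ℂ → ℂ} {C : ℝ}
    (hg : DifferentiableOn ℂ g (Metric.ball 0 1)) (hC : ∀ x ∈ Metric.ball (0 : ℂ) 1, ‖g x‖ ≤ C) :
    ∃ f : HardyInfty, ∀ s : RightHalfPlane,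
      (f : RightHalfPlane →ᵇ ℂ) s = g ((n : ℂ) ^ (-(s : ℂ))) := by
  have hmaps : Set.MapsTo (fun s : ℂ => (n : ℂ) ^ (-s)) {s | 0 < s.re} (Metric.ball 0 1) :=
    fun s hs => by simpa using norm_natCast_cpow_neg_lt_one hn hs
  have hn0 : (n : ℂ) ≠ 0 := by
    have : n ≠ 0 := by lia
    exact_mod_cast this
  have hd : DifferentiableOn ℂ (fun s : ℂ => g ((n : ℂ) ^ (-s))) {s | 0 < s.re} :=
    hg.comp (fun s _ => (DifferentiableAt.const_cpow (by fun_prop)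
      (.inl hn0)).differentiableWithinAt) hmaps
  have hcont : Continuous fun s : RightHalfPlane => g ((n : ℂ) ^ (-(s : ℂ))) :=
    continuousOn_iff_continuous_domRestrict.mp hd.continuousOn
  refine ⟨⟨BoundedContinuousFunction.ofNormedAddCommGroup _ hcont C fun s => hC _ (hmaps s.2),
    ⟨_, hd, fun s => rfl⟩, ?_⟩, fun s => rfl⟩
  let c : ℕ → ℂ := fun j => ((j.factorial : ℂ)⁻¹ * iteratedDeriv j g 0)
  -- The j-th Taylor coefficient of g sits at m = n ^ j, as (n⁻ˢ)^j = (n^j)⁻ˢ; the test detects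
  -- powers of n.
  refine ⟨fun m => if m = n ^ Nat.log n m then c (Nat.log n m) else 0, 0, fun s hs => ?_⟩
  have hx := hmaps (x := (s : ℂ)) s.2
  have hsum : HasSum (fun j => c j * ((n : ℂ) ^ (-(s : ℂ))) ^ j) (g ((n : ℂ) ^ (-(s : ℂ)))) := by
    refine (Complex.hasSum_taylorSeries_on_ball hg hx).congr_fun fun j => ?_
    simp only [c, smul_eq_mul, sub_zero]
    ring
  have hlog : Tendsto (fun N => Nat.log n N + 1) atTop atTop := by
    refine tendsto_atTop.mpr fun b => ?_
    filter_upwards [eventually_ge_atTop (n ^ b)] with N hN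
    have : b ≤ Nat.log n N := Nat.le_log_of_pow_le (by lia) hN
    lia
  -- The Dirichlet partial sum up to N is the Taylor partial sum over 0 ≤ j ≤ log_n N.
  refine (hsum.tendsto_sum_nat.comp hlog).congr' ?_
  filter_upwards [eventually_ge_atTop 1] with N hN
  refine Finset.sum_of_injOn (fun j => n ^ j) (Nat.pow_right_injective hn).injOn ?_ ?_ ?_
  · intro j hj
    have hj' : j ≤ Nat.log n N := by simpa [Nat.lt_succ_iff] using hj
    simp only [Finset.coe_Icc, Set.mem_Icc]
    exact ⟨Nat.one_le_pow _ _ (by lia), (Nat.le_log_iff_pow_le (by lia) (by lia)).mp hj'⟩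
  · intro m hm hm'
    rw [if_neg, zero_mul]
    intro h
    refine hm' ⟨Nat.log n m, ?_, h.symm⟩
    simpa [Nat.lt_succ_iff] using Nat.log_mono_right (Finset.mem_Icc.mp hm).2
  · intro j _
    have h1 : Nat.log n (n ^ j) = j := Nat.log_pow (by lia) j
    simp only [h1, if_true]
    congr 1
    rw [← Complex.cpow_nat_mul, Complex.natCast_cpow_natCast_mul]
    simp

/-! ### Boundary uniqueness and rigidity of the symbol. -/

/-- A bounded analytic function on the right half-plane with zero boundary values vanishes. -/
theorem eq_zero_of_norm_le_of_tendsto_boundary {h : ℂ → ℂ} {C : ℝ} {u : ℝ → ℝ}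
    (hd : DifferentiableOn ℂ h {s | 0 < s.re}) (hC : ∀ s : ℂ, 0 < s.re → ‖h s‖ ≤ C)
    (hu : Tendsto u (𝓝 0) (𝓝 0)) (hhu : ∀ s : ℂ, 0 < s.re → ‖h s‖ ≤ u s.re) {s : ℂ}
    (hs : 0 < s.re) : h s = 0 := by
  classical
  -- The bound by `u` makes the extension by zero continuous at the imaginary axis.
  let H : ℂ → ℂ := fun z => if 0 < z.re then h z else 0
  have hH (z : ℂ) (hz : 0 < z.re) : H z = h z := if_pos hz
  have hopen : IsOpen {z : ℂ | 0 < z.re} := isOpen_lt continuous_const Complex.continuous_re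
  have hHC (z : ℂ) : ‖H z‖ ≤ max C 0 := by
    by_cases hz : 0 < z.re
    · rw [hH z hz]
      exact (hC z hz).trans (le_max_left _ _)
    · simp [H, hz]
  have hHu (z : ℂ) : ‖H z‖ ≤ |u z.re| := by
    by_cases hz : 0 < z.re
    · rw [hH z hz]
      exact (hhu z hz).trans (le_abs_self _)
    · simp [H, hz]
  have hHd : DifferentiableOn ℂ H {z | 0 < z.re} := hd.congr hH
  have hdc : DiffContOnCl ℂ H {z | 0 < z.re} := by
    refine ⟨hHd, fun z hz => ContinuousAt.continuousWithinAt ?_⟩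
    rw [Complex.closure_setOfPred_lt_re] at hz
    rcases (show 0 ≤ z.re from hz).eq_or_lt with hz0 | hz0
    · have h0 : H z = 0 := if_neg (by simp [← hz0])
      rw [ContinuousAt, h0]
      refine squeeze_zero_norm hHu ?_
      have hre : Tendsto Complex.re (𝓝 z) (𝓝 0) := by
        rw [hz0]
        exact Complex.continuous_re.tendsto z
      simpa using (hu.comp hre).abs
    · exact (hHd.differentiableAt (hopen.mem_nhds hz0)).continuousAt
  -- Boundedness gives the growth condition (exponent 1, coefficient 0) and the bound on the real
  -- axis; the bound 0 on the imaginary axis then propagates inside.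
  have key := PhragmenLindelof.right_half_plane_of_bounded_on_real (C := 0) (z := s) hdc
    ⟨1, by norm_num, 0, ?_⟩ ⟨max C 0, by simpa using ⟨0, fun x _ => by simpa using hHC x⟩⟩
    (fun x => by simp [H]) hs.le
  · rw [← hH s hs]
    simpa using key
  · refine Asymptotics.IsBigO.of_bound (max C 0) (.of_forall fun z => ?_)
    simpa using hHC z

/-- log 3 / log 2 is irrational: both (w - z) log 2 and (w - z) log 3 lie in 2πiℤ, so if z ≠ w, then
3^|k| = 2^|m| with k ≠ 0, contradicting parity. -/
lemma eq_of_natCast_cpow_neg_eq {z w : ℂ} (h2 : ((2 : ℕ) : ℂ) ^ (-z) = ((2 : ℕ) : ℂ) ^ (-w))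
    (h3 : ((3 : ℕ) : ℂ) ^ (-z) = ((3 : ℕ) : ℂ) ^ (-w)) : z = w := by
  have key (n : ℕ) (hn : 2 ≤ n) (h : (n : ℂ) ^ (-z) = (n : ℂ) ^ (-w)) :
      ∃ k : ℤ, (w - z) * Real.log n = k * (2 * Real.pi * Complex.I) := by
    have hn0 : (n : ℂ) ≠ 0 := by
      have : n ≠ 0 := by lia
      exact_mod_cast this
    rw [Complex.cpow_def_of_ne_zero hn0, Complex.cpow_def_of_ne_zero hn0,
      Complex.exp_eq_exp_iff_exists_int] at h
    obtain ⟨k, hk⟩ := h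
    refine ⟨k, ?_⟩
    rw [← Complex.natCast_log] at hk
    linear_combination hk
  obtain ⟨k, hk⟩ := key 2 le_rfl h2
  obtain ⟨m, hm⟩ := key 3 (by norm_num) h3
  by_contra hne
  have hne' : w - z ≠ 0 := sub_ne_zero.mpr (Ne.symm hne)
  have hpi : (2 * Real.pi * Complex.I : ℂ) ≠ 0 := by
    simp [Real.pi_ne_zero]
  have hlog : (k : ℝ) * Real.log 3 = m * Real.log 2 := by
    have : (k : ℂ) * Real.log 3 = m * Real.log 2 := by
      apply mul_left_cancel₀ (mul_ne_zero hne' hpi)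
      push_cast at hk hm ⊢
      linear_combination (-(w - z) * Real.log 3 : ℂ) * hk + ((w - z) * Real.log 2 : ℂ) * hm
    exact_mod_cast this
  have h2 : 0 < Real.log 2 := Real.log_pos (by norm_num)
  have h3 : 0 < Real.log 3 := Real.log_pos (by norm_num)
  have hk0 : k ≠ 0 := by
    rintro rfl
    have : ((Real.log 2 : ℝ) : ℂ) ≠ 0 := by exact_mod_cast h2.ne'
    simp at hk
    simp_all
  have habs : (k.natAbs : ℝ) * Real.log 3 = m.natAbs * Real.log 2 := by
    have := congrArg abs hlog
    rwa [abs_mul, abs_mul, abs_of_pos h2, abs_of_pos h3, ← Int.cast_abs, ← Int.cast_abs,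
      ← Nat.cast_natAbs, ← Nat.cast_natAbs] at this
  rw [← Real.log_pow, ← Real.log_pow] at habs
  have hpow : (3 : ℝ) ^ k.natAbs = 2 ^ m.natAbs :=
    Real.log_injOn_pos (by simp) (by simp) habs
  have hpow' : 3 ^ k.natAbs = 2 ^ m.natAbs := by exact_mod_cast hpow
  have hodd : Odd (3 ^ k.natAbs) := Odd.pow (by decide)
  have hm0 : m.natAbs = 0 := by
    by_contra hm0
    rw [hpow'] at hodd
    exact (Nat.not_even_iff_odd.mpr hodd) ((Nat.even_pow.mpr ⟨even_two, hm0⟩))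
  rw [hm0, pow_zero] at hpow'
  have : k.natAbs = 0 := by simpa using hpow'
  exact hk0 (by simpa using this)

/-- A symbol moving `n⁻ˢ` by a bounded pseudohyperbolic distance less than one preserves `n⁻ˢ`. -/
theorem natCast_cpow_neg_eq_of_pseudoDist_lt {n : ℕ} (hn : 2 ≤ n)
    {Φ : RightHalfPlane → RightHalfPlane} (hΦ : IsHolomorphic fun s => (Φ s : ℂ))
    (h : ∀ s : RightHalfPlane,
      pseudoDist ((n : ℂ) ^ (-(s : ℂ))) ((n : ℂ) ^ (-(Φ s : ℂ))) < 1 / 2) (s : RightHalfPlane) :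
    (n : ℂ) ^ (-(Φ s : ℂ)) = (n : ℂ) ^ (-(s : ℂ)) := by
  obtain ⟨F, hF, hFΦ⟩ := hΦ
  beta_reduce at hFΦ
  have hn0 : (n : ℂ) ≠ 0 := by
    have : n ≠ 0 := by lia
    exact_mod_cast this
  have hFre (z : ℂ) (hz : 0 < z.re) : 0 < (F z).re := by
    rw [hFΦ ⟨z, hz⟩]
    exact (Φ ⟨z, hz⟩).2
  have hd : DifferentiableOn ℂ (fun z : ℂ => (n : ℂ) ^ (-F z) - (n : ℂ) ^ (-z)) {z | 0 < z.re} :=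
    (hF.neg.const_cpow (.inl hn0)).sub (differentiableOn_id.neg.const_cpow (.inl hn0))
  have hu : Tendsto (fun σ : ℝ => 1 - ((n : ℝ) ^ (-σ)) ^ 2) (𝓝 0) (𝓝 0) := by
    have hc : Continuous fun σ : ℝ => 1 - ((n : ℝ) ^ (-σ)) ^ 2 := by
      have : (n : ℝ) ≠ 0 := by exact_mod_cast hn0
      exact continuous_const.sub
        ((continuous_const.rpow continuous_neg fun _ => .inl this).pow 2)
    exact hc.tendsto' 0 0 (by simp)
  have hbound (z : ℂ) (hz : 0 < z.re) :
      ‖(n : ℂ) ^ (-F z) - (n : ℂ) ^ (-z)‖ ≤ 1 - ((n : ℝ) ^ (-z.re)) ^ 2 := by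
    have hp := h ⟨z, hz⟩
    rw [← hFΦ] at hp
    have hz1 := norm_natCast_cpow_neg_lt_one hn hz
    have hw1 := norm_natCast_cpow_neg_lt_one hn (hFre z hz)
    have hz2 : ‖(n : ℂ) ^ (-z)‖ = (n : ℝ) ^ (-z.re) := by
      rw [Complex.norm_natCast_cpow_of_pos (by lia), Complex.neg_re]
    rw [← hz2]
    rw [pseudoDist, div_lt_iff₀ (norm_one_sub_conj_mul_pos hz1 hw1)] at hp
    set x := (n : ℂ) ^ (-z)
    set y := (n : ℂ) ^ (-F z)
    -- With ρ < 1/2 this gives |x - y| ≤ (1 - |x|²)/2 + |x - y|/2, and the last term is absorbed on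
    -- the left.
    have h1 : ‖1 - (starRingEnd ℂ) x * y‖ ≤ (1 - ‖x‖ ^ 2) + ‖x‖ * ‖x - y‖ := by
      have : 1 - (starRingEnd ℂ) x * y
          = ((1 - ‖x‖ ^ 2 : ℝ) : ℂ) + (starRingEnd ℂ) x * (x - y) := by
        have := Complex.conj_mul' x
        push_cast
        linear_combination -this
      rw [this]
      refine (norm_add_le _ _).trans ?_
      rw [norm_mul, Complex.norm_conj, Complex.norm_real, Real.norm_of_nonneg]
      nlinarith [norm_nonneg x]
    rw [norm_sub_rev]
    nlinarith [norm_nonneg (x - y)]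
  have key := eq_zero_of_norm_le_of_tendsto_boundary (C := 1) hd
    (fun z hz => (hbound z hz).trans (by nlinarith [sq_nonneg ((n : ℝ) ^ (-z.re))])) hu hbound s.2
  rw [← hFΦ]
  exact sub_eq_zero.mp key

/-! ### Strong continuity forces uniformly small displacement. -/

lemma norm_sub_apply_le (f g : HardyInfty) (s : RightHalfPlane) :
    ‖(f : RightHalfPlane →ᵇ ℂ) s - (g : RightHalfPlane →ᵇ ℂ) s‖ ≤ ‖f - g‖ :=
  (f - g : RightHalfPlane →ᵇ ℂ).norm_coe_le_norm s

theorem eventually_pseudoDist_lt {T : ℝ≥0 → HardyInfty →L[ℂ] HardyInfty}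
    (hT : ∀ f, Tendsto (fun t : ℝ≥0 => T t f) (𝓝[>] 0) (𝓝 f))
    {Φ : ℝ≥0 → RightHalfPlane → RightHalfPlane}
    (hΦ : ∀ t (f : HardyInfty) (s : RightHalfPlane),
      (T t f : RightHalfPlane →ᵇ ℂ) s = (f : RightHalfPlane →ᵇ ℂ) (Φ t s))
    {n : ℕ} (hn : 2 ≤ n) :
    ∀ᶠ t in 𝓝[>] (0 : ℝ≥0), ∀ s : RightHalfPlane,
      pseudoDist ((n : ℂ) ^ (-(s : ℂ))) ((n : ℂ) ^ (-(Φ t s : ℂ))) < 1 / 2 := by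
  by_contra hcon
  have hfreq : ∃ᶠ t in 𝓝[>] (0 : ℝ≥0), ∃ s : RightHalfPlane,
      1 / 2 ≤ pseudoDist ((n : ℂ) ^ (-(s : ℂ))) ((n : ℂ) ^ (-(Φ t s : ℂ))) := by
    refine (not_eventually.mp hcon).mono fun t ht => ?_
    push Not at ht
    exact ht
  obtain ⟨t, ht, hs⟩ := exists_seq_forall_of_frequently hfreq
  choose s hs using hs
  set z : ℕ → ℂ := fun k => (n : ℂ) ^ (-(s k : ℂ))
  set w : ℕ → ℂ := fun k => (n : ℂ) ^ (-(Φ (t k) (s k) : ℂ))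
  have hz (k) : ‖z k‖ < 1 := norm_natCast_cpow_neg_lt_one hn (s k).2
  have hw (k) : ‖w k‖ < 1 := norm_natCast_cpow_neg_lt_one hn (Φ (t k) (s k)).2
  have hlim (g : ℂ → ℂ) (hg : DifferentiableOn ℂ g (Metric.ball 0 1))
      (hg1 : ∀ x ∈ Metric.ball (0 : ℂ) 1, ‖g x‖ ≤ 1) :
      Tendsto (fun k => ‖g (z k) - g (w k)‖) atTop (𝓝 0) := by
    obtain ⟨f, hf⟩ := exists_hardyInfty_comp_cpow hn hg hg1
    have h0 := tendsto_iff_norm_sub_tendsto_zero.mp ((hT f).comp ht)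
    refine squeeze_zero (fun _ => norm_nonneg _) (fun k => ?_) h0
    have := norm_sub_apply_le (T (t k) f) f (s k)
    rw [hΦ, hf, hf, norm_sub_rev] at this
    exact this
  have hzw : Tendsto (fun k => ‖z k - w k‖) atTop (𝓝 0) :=
    hlim (fun x => x) differentiableOn_id fun x hx => by simpa using (Metric.mem_ball.mp hx).le
  -- Small Euclidean but large pseudohyperbolic distance is possible only near the circle.
  have hle (k) : 1 - ‖z k‖ * ‖w k‖ ≤ 2 * ‖z k - w k‖ := by
    have h1 := hs k
    rw [pseudoDist, le_div_iff₀ (norm_one_sub_conj_mul_pos (hz k) (hw k))] at h1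
    linarith [one_sub_norm_mul_norm_le (z k) (w k)]
  have hone : Tendsto (fun k => 1 - 2 * ‖z k - w k‖) atTop (𝓝 1) := by
    simpa using (hzw.const_mul 2).const_sub 1
  have hzt : Tendsto (fun k => ‖z k‖) atTop (𝓝 1) :=
    tendsto_of_tendsto_of_tendsto_of_le_of_le hone tendsto_const_nhds
      (fun k => by nlinarith [hle k, hw k, norm_nonneg (z k)]) fun k => (hz k).le
  have hwt : Tendsto (fun k => ‖w k‖) atTop (𝓝 1) :=
    tendsto_of_tendsto_of_tendsto_of_le_of_le hone tendsto_const_nhds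
      (fun k => by nlinarith [hle k, hz k, norm_nonneg (w k)]) fun k => (hw k).le
  obtain ⟨g, hg, hg1, hfr⟩ := exists_bounded_analytic_frequently_le hz hw hzt hwt hs
  refine hfr ?_
  filter_upwards [(hlim g hg hg1).eventually_lt_const (by norm_num : (0 : ℝ) < 1 / 4)] with k hk
  exact not_le.mpr hk

/-! ### From small times to all times. -/

/-- A one-parameter semigroup which is trivial for small times is trivial. -/
lemma IsStronglyContinuousSemigroup.eq_id_of_eventually {X : Type*} [NormedAddCommGroup X]
    [NormedSpace ℂ X] {T : ℝ≥0 → X →L[ℂ] X} (hT : IsStronglyContinuousSemigroup T)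
    (h : ∀ᶠ t in 𝓝[>] (0 : ℝ≥0), T t = ContinuousLinearMap.id ℂ X) (t : ℝ≥0) :
    T t = ContinuousLinearMap.id ℂ X := by
  have hmul (u : ℝ≥0) (hu : T u = ContinuousLinearMap.id ℂ X) (k : ℕ) :
      T (k * u) = ContinuousLinearMap.id ℂ X := by
    induction k with
    | zero => simpa using hT.zero
    | succ k ih =>
      rw [Nat.cast_succ, add_one_mul, ← hT.add, ih, hu, ContinuousLinearMap.id_comp]
  rcases eq_or_ne t 0 with rfl | ht
  · exact hT.zero
  -- T_t is the (k+1)-st power of the operator at time t/(k+1), which is the identity for large k.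
  have hlim : Tendsto (fun k : ℕ => t / (k + 1)) atTop (𝓝[>] 0) := by
    refine tendsto_nhdsWithin_iff.mpr ⟨?_, .of_forall fun k => ?_⟩
    · have := (tendsto_const_div_atTop_nhds_zero_nat (𝕜 := ℝ) (t : ℝ)).comp (tendsto_add_atTop_nat 1)
      rw [← NNReal.tendsto_coe]
      simpa [Function.comp_def] using this
    · exact Set.mem_Ioi.mpr (by positivity)
  obtain ⟨k, hk⟩ := (hlim.eventually h).exists
  have := hmul _ hk (k + 1)
  rwa [Nat.cast_succ, mul_div_cancel₀ _ (by positivity)] at this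

theorem theorem7p1 (T : ℝ≥0 → HardyInfty →L[ℂ] HardyInfty)
    (hT : IsStronglyContinuousSemigroup T)
    (hcomp : ∀ t : ℝ≥0, IsCompositionOperator (T t)) :
    ∀ t : ℝ≥0, T t = ContinuousLinearMap.id ℂ HardyInfty := by
  choose Φ hΦ hTΦ using hcomp
  refine hT.eq_id_of_eventually ?_
  filter_upwards [eventually_pseudoDist_lt hT.tendsto hTΦ (n := 2) le_rfl,
    eventually_pseudoDist_lt hT.tendsto hTΦ (n := 3) (by norm_num)] with t h2 h3
  ext f s
  have : Φ t s = s := Subtype.ext <| eq_of_natCast_cpow_neg_eq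
    (natCast_cpow_neg_eq_of_pseudoDist_lt (n := 2) le_rfl (hΦ t) h2 s)
    (natCast_cpow_neg_eq_of_pseudoDist_lt (n := 3) (by norm_num) (hΦ t) h3 s)
  rw [hTΦ, this]
  rfl
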